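/- Let $r\ge 2$, let $\alpha_1\ge\alpha_2\ge\cdots\ge\alpha_r>0$, and let $m_1,\dots,m_r>0$ and $\nu>0$ be real numbers. Let $X_1,\dots,X_r$ be independent random variables, $X_i$ having the chi-square distribution with $m_i$ degrees of freedom, and let $V$ have the chi-square distribution with $\nu$ degrees of freedom, independently of $(X_1,\dots,X_r)$. Put $|m|=m_1+\cdots+m_r$ and $$W=\frac{(\alpha_1X_1+\cdots+\alpha_rX_r)/|m|}{V/\nu},$$ and let $H_W$ be the cumulative distribution function of $W$. Set $$A=\prod_{i=1}^r\Big(\frac{\alpha_i}{\alpha_r}\Big)^{-m_i/2},\qquad u_i=1-\frac{\alpha_r}{\alpha_i},\qquad a=\frac{\nu\alpha_r}{|m|},\qquad B_0=a^{\nu/2}\frac{\Gamma\big(\frac{\nu+|m|}2\big)}{\Gamma\big(\frac{|m|}2\big)\Gamma\big(\frac{\nu}2\big)},\qquad t(y)=\frac{y}{a+y},$$ and let $c_0,c_1,\dots$ be the coefficients of the power series $A\prod_{i=1}^r(1-u_iz)^{-m_i/2}=\sum_{j\ge0}c_jz^j$ about $z=0$. Write $(x)_k=x(x+1)\cdots(x+k-1)$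 and $$F_D^{(r)}(\beta;b_1,\dots,b_r;\gamma;x_1,\dots,x_r)=\sum_{i_1,\dots,i_r\ge0}\frac{(\beta)_{i_1+\cdots+i_r}}{(\gamma)_{i_1+\cdots+i_r}}\prod_{k=1}^r\frac{(b_k)_{i_k}}{i_k!}x_k^{i_k}$$ for the Lauricella function. Then for every $y\ge0$ the two series below converge absolutely and $$H_W(y)=AB_0\,\frac{y^{|m|/2}}{(|m|/2)(a+y)^{(\nu+|m|)/2}}\;F_D^{(r)}\Big(\tfrac{\nu+|m|}2;\tfrac{m_1}2,\dots,\tfrac{m_{r-1}}2,1;\tfrac{|m|}2+1;t(y)u_1,\dots,t(y)u_{r-1},t(y)\Big),$$ $$H_W(y)=B_0\,y^{|m|/2}(a+y)^{-(\nu+|m|)/2}\sum_{j=0}^\infty\frac{\big(\frac{\nu+|m|}2\big)_j}{\big(\frac{|m|}2\big)_{j+1}}\,t(y)^j\sum_{i=0}^jc_i.$$ -/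

import Mathlib

open MeasureTheory ProbabilityTheory

noncomputable section

namespace GenF

/-- The chi-square distribution with `k` degrees of freedom (`k > 0` real): the measure on `ℝ` with
density `x ^ (k / 2 - 1) * exp (-x / 2) / (2 ^ (k / 2) * Γ (k / 2))` on the positive half-line. -/
def chiSquare (k : ℝ) : Measure ℝ := gammaMeasure (k / 2) (1 / 2)

/-- The Pochhammer symbol `(a)_k = a (a + 1) ⋯ (a + k - 1)`. -/
def poch (a : ℝ) (k : ℕ) : ℝ := (ascPochhammer ℝ k).eval a

/-- The general term of the Lauricella series `F_D^{(s)}(a; b₁, …, b_s; c; x₁, …, x_s)`. -/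
def lauricellaFDTerm {s : ℕ} (a : ℝ) (b : Fin s → ℝ) (c : ℝ) (x : Fin s → ℝ)
    (i : Fin s → ℕ) : ℝ :=
  poch a (∑ k, i k) / poch c (∑ k, i k) *
    ∏ k, poch (b k) (i k) / (Nat.factorial (i k) : ℝ) * x k ^ i k

/-- The Lauricella function `F_D^{(s)}(a; b₁, …, b_s; c; x₁, …, x_s)`, as the sum of its multiple
power series. -/
def lauricellaFD {s : ℕ} (a : ℝ) (b : Fin s → ℝ) (c : ℝ) (x : Fin s → ℝ) : ℝ :=
  ∑' i : Fin s → ℕ, lauricellaFDTerm a b c x i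

/-- The total number of degrees of freedom `|m| = m₁ + ⋯ + m_r`, with `r = n + 1`. -/
def mTot {n : ℕ} (m : Fin (n + 1) → ℝ) : ℝ := ∑ i, m i

/-- `W = (T / |m|) / (V / ν)` with `T = α₁ X₁ + ⋯ + α_r X_r`. -/
def genFStat {n : ℕ} {Ω : Type*} (α m : Fin (n + 1) → ℝ) (ν : ℝ)
    (X : Fin (n + 1) → Ω → ℝ) (V : Ω → ℝ) (ω : Ω) : ℝ :=
  ((∑ i, α i * X i ω) / mTot m) / (V ω / ν)

/-- `A = ∏ i, (α i / α_r) ^ (-m i / 2)`. -/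
def constA {n : ℕ} (α m : Fin (n + 1) → ℝ) : ℝ :=
  ∏ i, (α i / α (Fin.last n)) ^ (-(m i / 2))

/-- `u i = 1 - α_r / α i`. -/
def uCoef {n : ℕ} (α : Fin (n + 1) → ℝ) (i : Fin (n + 1)) : ℝ :=
  1 - α (Fin.last n) / α i

/-- The generating function `z ↦ A * ∏ i, (1 - u i * z) ^ (-m i / 2)`. -/
def genFun {n : ℕ} (α m : Fin (n + 1) → ℝ) (z : ℝ) : ℝ :=
  constA α m * ∏ i, (1 - uCoef α i * z) ^ (-(m i / 2))

/-- `c j` is the coefficient of `z ^ j` in the power series expansion of the generating function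
about `z = 0`. -/
def cCoef {n : ℕ} (α m : Fin (n + 1) → ℝ) (j : ℕ) : ℝ :=
  iteratedDeriv j (genFun α m) 0 / (Nat.factorial j : ℝ)

/-- `a = ν α_r / |m|`. -/
def aParam {n : ℕ} (α m : Fin (n + 1) → ℝ) (ν : ℝ) : ℝ :=
  ν * α (Fin.last n) / mTot m

/-- `B₀ = a ^ (ν / 2) * Γ ((ν + |m|) / 2) / (Γ (|m| / 2) * Γ (ν / 2))`. -/
def constB0 {n : ℕ} (α m : Fin (n + 1) → ℝ) (ν : ℝ) : ℝ :=
  aParam α m ν ^ (ν / 2) * Real.Gamma ((ν + mTot m) / 2) /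
    (Real.Gamma (mTot m / 2) * Real.Gamma (ν / 2))

/-- `t y = y / (a + y)`. -/
def tFun {n : ℕ} (α m : Fin (n + 1) → ℝ) (ν y : ℝ) : ℝ :=
  y / (aParam α m ν + y)

/-- The numerator parameters `(m₁ / 2, …, m_{r-1} / 2, 1)`. -/
def bVec {n : ℕ} (m : Fin (n + 1) → ℝ) : Fin (n + 1) → ℝ :=
  Fin.snoc (α := fun _ => ℝ) (fun k : Fin n => m k.castSucc / 2) 1

/-- The arguments `(t(y) u₁, …, t(y) u_{r-1}, t(y))`. -/
def xVec {n : ℕ} (α m : Fin (n + 1) → ℝ) (ν y : ℝ) : Fin (n + 1) → ℝ :=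
  Fin.snoc (α := fun _ => ℝ) (fun k : Fin n => tFun α m ν y * uCoef α k.castSucc) (tFun α m ν y)

/-- The general term of the single series for the distribution function:
`((ν + |m|) / 2)_j / (|m| / 2)_{j + 1} * t(y) ^ j * (c 0 + ⋯ + c j)`. -/
def cdfSeriesTerm {n : ℕ} (α m : Fin (n + 1) → ℝ) (ν y : ℝ) (j : ℕ) : ℝ :=
  poch ((ν + mTot m) / 2) j / poch (mTot m / 2) (j + 1) * tFun α m ν y ^ j *
    ∑ i ∈ Finset.range (j + 1), cCoef α m i

end GenF

end

noncomputable section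

namespace GenF

open scoped ENNReal
open Set Real

/-! Put `r = 1 / (2 * α_r)`. Each `α_k X_k` is gamma of rate `r * (1 - u_k)`, hence a negative
binomial mixture of gamma laws of the single rate `r` (`gammaMeasure_eq_sum`). By independence the
mixtures multiply, and gamma laws of one rate add their shapes, so `∑ α_k X_k` is a mixture, over
multi-indices `i`, of gamma laws of shape `|m|/2 + ∑ i_k` (`hasLaw_sum`).

For a component of degree `N`, the gamma distribution function is a series with positive terms
indexed by `l`. Integrating it against the law of `V` gives terms that depend on `N + l` alone,
namely `cdfKernel (N + l)` (`lintegral_gammaMeasure_eq_cdfKernel`).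

The two formulas are two ways to sum over `(i, l)`. Since `u_r = 0`, the index `i_r` is always `0`
and `l` takes its place: this is the Lauricella series, with last parameter `1`. Grouping instead by
`N + l` gives partial sums of degree weights, which are the `c_j` by comparison of generating
functions (`cCoef_eq_toReal_degWeight`). All sums live in `ℝ≥0∞`, so rearrangement is free, and
convergence follows because the total is a probability. -/

/-! ### Products of mixtures, and Pochhammer symbols. -/

lemma prod_tsum_eq_tsum_pi {n : ℕ} (f : Fin n → ℕ → ℝ≥0∞) :
    ∏ k, ∑' j, f k j = ∑' i : Fin n → ℕ, ∏ k, f k (i k) := by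
  induction n with
  | zero => simp
  | succ n ih =>
    rw [Fin.prod_univ_succ, ih, ← (Fin.consEquiv fun _ : Fin (n + 1) => ℕ).tsum_eq,
      ENNReal.tsum_prod']
    simp only [Fin.consEquiv_apply, Fin.prod_univ_succ, Fin.cons_zero, Fin.cons_succ]
    simp_rw [ENNReal.tsum_mul_left, ENNReal.tsum_mul_right]

/-- A product measure is determined by boxes, and on a box this is the expansion of a finite product
of series. -/
lemma pi_sum_smul {n : ℕ} {E : Type*} [MeasurableSpace E] (c : Fin n → ℕ → ℝ≥0∞)
    (μ : Fin n → ℕ → Measure E) [∀ k j, SigmaFinite (μ k j)]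
    [∀ k, SigmaFinite (Measure.sum fun j => c k j • μ k j)] :
    Measure.pi (fun k => Measure.sum fun j => c k j • μ k j) =
      Measure.sum fun i : Fin n → ℕ => (∏ k, c k (i k)) • Measure.pi fun k => μ k (i k) := by
  refine Measure.pi_eq fun s hs => ?_
  rw [Measure.sum_apply _ (MeasurableSet.univ_pi hs)]
  simp_rw [Measure.smul_apply, Measure.pi_pi, smul_eq_mul, ← Finset.prod_mul_distrib,
    fun k => Measure.sum_apply (fun j => c k j • μ k j) (hs k), Measure.smul_apply, smul_eq_mul]
  exact (prod_tsum_eq_tsum_pi fun k j => c k j * μ k j (s k)).symm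

lemma Gamma_add_natCast {a : ℝ} (ha : 0 < a) (k : ℕ) :
    Gamma (a + k) = poch a k * Gamma a := by
  induction k with
  | zero => simp [poch]
  | succ k ih =>
    have h : a + k ≠ 0 := by positivity
    rw [Nat.cast_succ, ← add_assoc, Gamma_add_one h, ih, poch, poch, ascPochhammer_succ_eval]
    ring

lemma poch_pos {a : ℝ} (ha : 0 < a) (k : ℕ) : 0 < poch a k := ascPochhammer_pos k a ha

lemma poch_succ_left (a : ℝ) (k : ℕ) : poch a (k + 1) = a * poch (a + 1) k := by
  simp [poch, ascPochhammer_succ_left, Polynomial.eval_comp]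

lemma poch_one (k : ℕ) : poch 1 k = (Nat.factorial k : ℝ) := by
  rw [poch, ascPochhammer_eval_one]

/-! ### Gamma laws: mixtures, scaling, convolution, distribution function. -/

lemma gammaMeasure_eq_withDensity_Ioi (s r : ℝ) :
    gammaMeasure s r = (volume.restrict (Ioi 0)).withDensity
      fun x => ENNReal.ofReal (r ^ s / Gamma s * x ^ (s - 1) * exp (-(r * x))) := by
  rw [gammaMeasure, ← withDensity_indicator measurableSet_Ioi]
  refine withDensity_congr_ae ?_
  filter_upwards [Measure.ae_ne volume (0 : ℝ)] with x hx
  rcases lt_or_gt_of_ne hx with h | h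
  · rw [gammaPDF_of_neg h, indicator_of_notMem (by simpa using h.le)]
  · rw [gammaPDF_of_nonneg h.le, indicator_of_mem (by simpa using h)]

lemma lintegral_gammaMeasure (s r : ℝ) {f : ℝ → ℝ≥0∞} (hf : Measurable f) :
    ∫⁻ x, f x ∂(gammaMeasure s r) = ∫⁻ x in Ioi 0,
      ENNReal.ofReal (r ^ s / Gamma s * x ^ (s - 1) * exp (-(r * x))) * f x := by
  rw [gammaMeasure_eq_withDensity_Ioi, lintegral_withDensity_eq_lintegral_mul _ (by fun_prop) hf]
  rfl

/-- Read off from the total mass `1` of the gamma law. -/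
lemma lintegral_rpow_mul_exp_neg {s r : ℝ} (hs : 0 < s) (hr : 0 < r) :
    ∫⁻ x in Ioi 0, ENNReal.ofReal (x ^ (s - 1) * exp (-(r * x))) =
      ENNReal.ofReal (Gamma s / r ^ s) := by
  have h := isProbabilityMeasure_gammaMeasure hs hr
  have hG := Gamma_pos_of_pos hs
  have h1 : ∫⁻ _, 1 ∂(gammaMeasure s r) = 1 := by simp
  rw [lintegral_gammaMeasure s r measurable_const] at h1
  have hc : 0 < r ^ s / Gamma s := by positivity
  simp_rw [mul_one, mul_assoc, ENNReal.ofReal_mul hc.le] at h1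
  rw [lintegral_const_mul _ (by fun_prop)] at h1
  rw [ENNReal.eq_inv_of_mul_eq_one_left ((mul_comm _ _).trans h1),
    ← ENNReal.ofReal_inv_of_pos hc, inv_div]

lemma ae_pos_gammaMeasure (s r : ℝ) : ∀ᵐ x ∂(gammaMeasure s r), 0 < x := by
  rw [gammaMeasure_eq_withDensity_Ioi]
  exact (withDensity_absolutelyContinuous _ _).ae_le (ae_restrict_mem measurableSet_Ioi)

/-- A gamma law of rate `r * (1 - u)` is a negative binomial mixture of gamma laws of rate `r`. -/
lemma gammaMeasure_eq_sum {s r u : ℝ} (hs : 0 < s) (hr : 0 < r) (hu0 : 0 ≤ u) (hu1 : u < 1) :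
    gammaMeasure s (r * (1 - u)) = Measure.sum fun j : ℕ =>
      ENNReal.ofReal ((1 - u) ^ s * (poch s j / (Nat.factorial j : ℝ) * u ^ j)) •
        gammaMeasure (s + j) r := by
  simp_rw [gammaMeasure_eq_withDensity_Ioi]
  simp_rw [← withDensity_smul' _ (f := fun x => ENNReal.ofReal _) ENNReal.ofReal_ne_top]
  rw [← withDensity_tsum (fun j => by fun_prop)]
  refine withDensity_congr_ae ?_
  filter_upwards [ae_restrict_mem measurableSet_Ioi] with x hx
  have hx : 0 < x := hx
  have h1u : 0 < 1 - u := by linarith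
  have hG := Gamma_pos_of_pos hs
  rw [ENNReal.tsum_apply]
  simp only [Pi.smul_apply, smul_eq_mul]
  -- Expand `exp (r * x * u)` in `exp (-(r * (1 - u) * x)) = exp (-(r * x)) * exp (r * x * u)`; as
  -- `Γ (s + j) = (s)_j Γ (s)`, the `j`-th term is a multiple of the density of shape `s + j`.
  have hterm : ∀ j : ℕ, ENNReal.ofReal ((1 - u) ^ s * (poch s j / (Nat.factorial j : ℝ) * u ^ j)) *
      ENNReal.ofReal (r ^ (s + j) / Gamma (s + j) * x ^ (s + j - 1) * exp (-(r * x))) =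
      ENNReal.ofReal ((r * (1 - u)) ^ s / Gamma s * x ^ (s - 1) * exp (-(r * x)) *
        ((r * x * u) ^ j / (Nat.factorial j : ℝ))) := by
    intro j
    have hp := poch_pos hs j
    rw [← ENNReal.ofReal_mul (by positivity), Gamma_add_natCast hs, rpow_add_natCast hr.ne',
      add_sub_right_comm, rpow_add_natCast hx.ne', mul_rpow hr.le h1u.le]
    congr 1
    field_simp
    ring
  simp_rw [hterm]
  have hS : HasSum (fun j : ℕ => (r * x * u) ^ j / (Nat.factorial j : ℝ)) (exp (r * x * u)) := by
    rw [exp_eq_exp_ℝ]; exact NormedSpace.expSeries_div_hasSum_exp (r * x * u)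
  rw [← ENNReal.ofReal_tsum_of_nonneg (fun j => by positivity) (hS.summable.mul_left _),
    tsum_mul_left, hS.tsum_eq, mul_assoc, mul_assoc, mul_assoc, ← exp_add, ← mul_assoc]
  congr 4
  ring

/-- The beta density has mass `1`; rescale `(0, 1)` to `(0, z)`. -/
lemma lintegral_rpow_mul_rpow_sub {s t z : ℝ} (hs : 0 < s) (ht : 0 < t) (hz : 0 < z) :
    ∫⁻ x in Ioo 0 z, ENNReal.ofReal (x ^ (s - 1) * (z - x) ^ (t - 1)) =
      ENNReal.ofReal (z ^ (s + t - 1) * (Gamma s * Gamma t / Gamma (s + t))) := by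
  have hb : 0 < beta s t := beta_pos hs ht
  have h1 := lintegral_betaPDF_eq_one hs ht
  rw [lintegral_betaPDF] at h1
  simp_rw [mul_assoc, ENNReal.ofReal_mul (one_div_pos.2 hb).le] at h1
  rw [lintegral_const_mul _ (by fun_prop)] at h1
  have h2 : ∫⁻ x in Ioo (0 : ℝ) 1, ENNReal.ofReal (x ^ (s - 1) * (1 - x) ^ (t - 1)) =
      ENNReal.ofReal (beta s t) := by
    rw [ENNReal.eq_inv_of_mul_eq_one_left ((mul_comm _ _).trans h1),
      ← ENNReal.ofReal_inv_of_pos (one_div_pos.2 hb), inv_div, div_one]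
  have himg : (fun x => z * x) '' Ioo 0 1 = Ioo 0 z := by
    rw [image_mul_left_Ioo hz]; simp
  rw [← himg, lintegral_image_eq_lintegral_abs_deriv_mul (f' := fun _ => z) measurableSet_Ioo
    (fun x _ => by simpa using ((hasDerivAt_id x).const_mul z).hasDerivWithinAt)
    (mul_right_injective₀ hz.ne').injOn,
    setLIntegral_congr_fun (g := fun x => ENNReal.ofReal (z ^ (s + t - 1)) *
      ENNReal.ofReal (x ^ (s - 1) * (1 - x) ^ (t - 1))) measurableSet_Ioo,
    lintegral_const_mul _ (by fun_prop), h2, ← ENNReal.ofReal_mul (by positivity)]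
  · rfl
  · intro x hx
    have h0 : 0 < x := hx.1
    have h1 : 0 < 1 - x := sub_pos.2 hx.2
    simp only []
    rw [abs_of_pos hz, ← ENNReal.ofReal_mul hz.le, ← ENNReal.ofReal_mul (by positivity),
      mul_rpow hz.le h0.le, show z - z * x = z * (1 - x) by ring, mul_rpow hz.le h1.le,
      show s + t - 1 = (s - 1) + (t - 1) + 1 by ring, rpow_add_one hz.ne', rpow_add hz]
    congr 1
    ring

lemma gammaMeasure_map_const_mul {s r c : ℝ} (hr : 0 < r) (hc : 0 < c) :
    (gammaMeasure s r).map (fun x => c * x) = gammaMeasure s (r / c) := by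
  refine Measure.ext_of_lintegral _ fun f hf => ?_
  have himg : (fun x => c * x) '' Ioi 0 = Ioi 0 := by
    rw [image_mul_left_Ioi hc]; simp
  rw [lintegral_map hf (by fun_prop), lintegral_gammaMeasure _ _ (by fun_prop),
    lintegral_gammaMeasure _ _ hf]
  conv_rhs => rw [← himg]
  rw [lintegral_image_eq_lintegral_abs_deriv_mul (f' := fun _ => c) measurableSet_Ioi
    (fun x _ => by simpa using ((hasDerivAt_id x).const_mul c).hasDerivWithinAt)
    (mul_right_injective₀ hc.ne').injOn]
  refine setLIntegral_congr_fun measurableSet_Ioi fun x hx => ?_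
  have hx : 0 < x := hx
  rw [← mul_assoc, abs_of_pos hc, ← ENNReal.ofReal_mul hc.le, div_rpow hr.le hc.le,
    mul_rpow hc.le hx.le, rpow_sub_one hc.ne']
  congr 2
  rw [show r / c * (c * x) = r * x by field_simp]
  have : 0 < c ^ s := by positivity
  field_simp

lemma gammaMeasure_conv {s t r : ℝ} (hs : 0 < s) (ht : 0 < t) (hr : 0 < r) :
    (gammaMeasure s r).conv (gammaMeasure t r) = gammaMeasure (s + t) r := by
  have hGs := Gamma_pos_of_pos hs
  have hGt := Gamma_pos_of_pos ht
  have hm : ∀ s, Measurable (gammaPDF s r) := fun s => by unfold gammaPDF; fun_prop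
  simp only [gammaMeasure]
  rw [conv_withDensity_eq_lconvolution (hm s) (hm t)]
  refine withDensity_congr_ae ?_
  filter_upwards [Measure.ae_ne volume (0 : ℝ)] with z hz
  rw [lconvolution_def]
  rcases lt_or_gt_of_ne hz with hz | hz
  · rw [gammaPDF_of_neg hz]
    refine (lintegral_congr fun x => ?_).trans lintegral_zero
    rcases lt_or_ge x 0 with hx | hx
    · rw [gammaPDF_of_neg hx, zero_mul]
    · rw [gammaPDF_of_neg (x := -x + z) (by linarith), mul_zero]
  · have hz : 0 < z := hz
    have h : (fun x => gammaPDF s r x * gammaPDF t r (-x + z)) =ᵐ[volume]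
        (Ioo 0 z).indicator fun x =>
          ENNReal.ofReal (r ^ (s + t) / (Gamma s * Gamma t) * exp (-(r * z))) *
            ENNReal.ofReal (x ^ (s - 1) * (z - x) ^ (t - 1)) := by
      filter_upwards [Measure.ae_ne volume (0 : ℝ), Measure.ae_ne volume z] with x hx0 hxz
      rcases lt_or_gt_of_ne hx0 with h0 | h0
      · rw [gammaPDF_of_neg h0, zero_mul, indicator_of_notMem fun h => h0.not_gt h.1]
      rcases lt_or_gt_of_ne hxz with h1 | h1
      · have h0' : 0 < x := h0
        have h1' : 0 < z - x := sub_pos.2 h1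
        rw [indicator_of_mem (show x ∈ Ioo 0 z from ⟨h0, h1⟩), gammaPDF_of_nonneg h0'.le, neg_add_eq_sub,
          gammaPDF_of_nonneg h1'.le, ← ENNReal.ofReal_mul (by positivity),
          ← ENNReal.ofReal_mul (by positivity), rpow_add hr,
          show -(r * z) = -(r * x) + -(r * (z - x)) by ring, exp_add]
        congr 1
        field_simp
      · rw [gammaPDF_of_neg (x := -x + z) (by linarith), mul_zero,
          indicator_of_notMem fun h => h1.not_gt h.2]
    rw [lintegral_congr_ae h, lintegral_indicator measurableSet_Ioo,
      lintegral_const_mul _ (by fun_prop), lintegral_rpow_mul_rpow_sub hs ht hz,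
      gammaPDF_of_nonneg hz.le, ← ENNReal.ofReal_mul (by positivity)]
    congr 1
    field_simp

/-- Characteristic functions turn both the sum of coordinates and `gammaMeasure_conv` into products,
and they determine the law. -/
lemma pi_gammaMeasure_map_sum {n : ℕ} {s : Fin (n + 1) → ℝ} {r : ℝ} (hs : ∀ k, 0 < s k)
    (hr : 0 < r) :
    (Measure.pi fun k => gammaMeasure (s k) r).map (fun x => ∑ k, x k) =
      gammaMeasure (∑ k, s k) r := by
  have hp : ∀ k, IsProbabilityMeasure (gammaMeasure (s k) r) :=
    fun k => isProbabilityMeasure_gammaMeasure (hs k) hr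
  have hsum : ∀ m (s : Fin (m + 1) → ℝ), (∀ k, 0 < s k) →
      ∏ k, charFun (gammaMeasure (s k) r) = charFun (gammaMeasure (∑ k, s k) r) := by
    intro m
    induction m with
    | zero => intro s hs; simp
    | succ m ih =>
      intro s hs
      have h0 := isProbabilityMeasure_gammaMeasure (hs 0) hr
      have hpos : 0 < ∑ k : Fin (m + 1), s k.succ :=
        Finset.sum_pos (fun k _ => hs _) Finset.univ_nonempty
      have h1 := isProbabilityMeasure_gammaMeasure hpos hr
      rw [Fin.prod_univ_succ, ih _ fun k => hs _, Fin.sum_univ_succ s,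
        ← gammaMeasure_conv (hs 0) hpos hr]
      ext t
      rw [charFun_conv, Pi.mul_apply]
  have hpos : 0 < ∑ k, s k := Finset.sum_pos (fun k _ => hs _) Finset.univ_nonempty
  have h1 := isProbabilityMeasure_gammaMeasure hpos hr
  refine Measure.ext_of_charFun ?_
  rw [charFun_map_sum_pi_eq_prod, hsum n s hs]

/-- Writing `exp (-(r * y)) = exp (-(r * x)) * exp (r * (x - y))` before expanding keeps every term
nonnegative and makes each one a beta integral. -/
lemma gammaMeasure_Iic {s r x : ℝ} (hs : 0 < s) (hr : 0 < r) (hx : 0 < x) :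
    gammaMeasure s r (Iic x) = ∑' l : ℕ,
      ENNReal.ofReal ((r * x) ^ (s + l) * exp (-(r * x)) / Gamma (s + l + 1)) := by
  have hG := Gamma_pos_of_pos hs
  rw [gammaMeasure_eq_withDensity_Ioi, withDensity_apply _ measurableSet_Iic,
    Measure.restrict_restrict measurableSet_Iic, inter_comm, Ioi_inter_Iic,
    ← Measure.restrict_congr_set (Ioo_ae_eq_Ioc (μ := volume) (a := 0) (b := x)),
    setLIntegral_congr_fun (g := fun y => ∑' l : ℕ, ENNReal.ofReal
      (r ^ s / Gamma s * exp (-(r * x)) * (r ^ l / (Nat.factorial l : ℝ))) *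
        ENNReal.ofReal (y ^ (s - 1) * (x - y) ^ ((l + 1 : ℝ) - 1))) measurableSet_Ioo,
    lintegral_tsum fun l => by fun_prop]
  · refine tsum_congr fun l => ?_
    have hGl : 0 < Gamma (s + l + 1) := Gamma_pos_of_pos (by positivity)
    rw [lintegral_const_mul _ (by fun_prop), lintegral_rpow_mul_rpow_sub hs (by positivity) hx,
      ← ENNReal.ofReal_mul (by positivity), Gamma_nat_eq_factorial, ← add_assoc,
      add_sub_cancel_right, mul_rpow hr.le hx.le, rpow_add_natCast hr.ne']
    congr 1
    field_simp
  · intro y hy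
    have h0 : 0 < y := hy.1
    have h1 : 0 < x - y := sub_pos.2 hy.2
    have hS : HasSum (fun l : ℕ => (r * (x - y)) ^ l / (Nat.factorial l : ℝ))
        (exp (r * (x - y))) := by
      rw [exp_eq_exp_ℝ]; exact NormedSpace.expSeries_div_hasSum_exp _
    have hterm : ∀ l : ℕ, ENNReal.ofReal
        (r ^ s / Gamma s * exp (-(r * x)) * (r ^ l / (Nat.factorial l : ℝ))) *
        ENNReal.ofReal (y ^ (s - 1) * (x - y) ^ ((l + 1 : ℝ) - 1)) =
        ENNReal.ofReal (r ^ s / Gamma s * y ^ (s - 1) * exp (-(r * x)) *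
          ((r * (x - y)) ^ l / (Nat.factorial l : ℝ))) := by
      intro l
      rw [← ENNReal.ofReal_mul (by positivity), add_sub_cancel_right, rpow_natCast, mul_pow]
      congr 1
      ring
    simp only [hterm]
    rw [← ENNReal.ofReal_tsum_of_nonneg (fun l => by positivity) (hS.summable.mul_left _),
      tsum_mul_left, hS.tsum_eq, mul_assoc, mul_assoc, mul_assoc, ← exp_add]
    congr 4
    ring

/-- The weight of the `j`-th component in the negative binomial mixture for `α k * X k`. -/
def mixWeight {n : ℕ} (α m : Fin (n + 1) → ℝ) (k : Fin (n + 1)) (j : ℕ) : ℝ :=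
  (1 - uCoef α k) ^ (m k / 2) * (poch (m k / 2) j / (Nat.factorial j : ℝ) * uCoef α k ^ j)

/-! ### Mixture weights and the law of the weighted sum. -/

section Weights

variable {n : ℕ} {α m : Fin (n + 1) → ℝ}

lemma uCoef_nonneg (hα : ∀ i, 0 < α i) (hαa : Antitone α) (k : Fin (n + 1)) : 0 ≤ uCoef α k :=
  sub_nonneg.2 ((div_le_one (hα k)).2 (hαa (Fin.le_last k)))

lemma uCoef_lt_one (hα : ∀ i, 0 < α i) (k : Fin (n + 1)) : uCoef α k < 1 :=
  sub_lt_self _ (div_pos (hα _) (hα k))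

lemma uCoef_last (hα : ∀ i, 0 < α i) : uCoef α (Fin.last n) = 0 := by
  rw [uCoef, div_self (hα _).ne', sub_self]

lemma mixWeight_nonneg (hα : ∀ i, 0 < α i) (hαa : Antitone α) (hm : ∀ i, 0 < m i)
    (k : Fin (n + 1)) (j : ℕ) : 0 ≤ mixWeight α m k j := by
  have h0 := uCoef_nonneg hα hαa k
  have h1 := sub_pos.2 (uCoef_lt_one hα k)
  have h2 := poch_pos (half_pos (hm k)) j
  unfold mixWeight
  positivity

lemma mTot_pos (hm : ∀ i, 0 < m i) : 0 < mTot m :=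
  Finset.sum_pos (fun k _ => hm k) Finset.univ_nonempty

lemma constA_eq (hα : ∀ i, 0 < α i) :
    constA α m = ∏ k, (1 - uCoef α k) ^ (m k / 2) := by
  refine Finset.prod_congr rfl fun k _ => ?_
  rw [uCoef, sub_sub_cancel, rpow_neg (div_pos (hα _) (hα _)).le,
    ← inv_rpow (div_pos (hα _) (hα _)).le, inv_div]

lemma constA_pos (hα : ∀ i, 0 < α i) : 0 < constA α m :=
  Finset.prod_pos fun _ _ => rpow_pos_of_pos (div_pos (hα _) (hα _)) _

end Weights

/-- The law of `∑ i, α i * X i`, for independent chi-square variables `X i`. -/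
def sumLaw {n : ℕ} (α m : Fin (n + 1) → ℝ) : Measure ℝ :=
  Measure.sum fun i : Fin (n + 1) → ℕ => (∏ k, ENNReal.ofReal (mixWeight α m k (i k))) •
    gammaMeasure (mTot m / 2 + (∑ k, i k : ℕ)) (1 / (2 * α (Fin.last n)))

lemma hasLaw_sum {Ω : Type*} [MeasurableSpace Ω] {P : Measure Ω} [IsProbabilityMeasure P] {n : ℕ}
    {α m : Fin (n + 1) → ℝ} (hα : ∀ i, 0 < α i) (hαa : Antitone α) (hm : ∀ i, 0 < m i)
    {X : Fin (n + 1) → Ω → ℝ} (hX : ∀ i, HasLaw (X i) (chiSquare (m i)) P) (hXi : iIndepFun X P) :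
    HasLaw (fun ω => ∑ i, α i * X i ω) (sumLaw α m) P := by
  -- The largest of the rates `1 / (2 * α k)`, each of which equals `r * (1 - uCoef α k)`.
  set r : ℝ := 1 / (2 * α (Fin.last n)) with hr_def
  have hr : 0 < r := by have := hα (Fin.last n); positivity
  have hY : ∀ i, HasLaw (fun ω => α i * X i ω) (gammaMeasure (m i / 2) (r * (1 - uCoef α i))) P := by
    intro i
    have h := HasLaw.fun_comp (Y := fun x => α i * x) (ν := gammaMeasure (m i / 2) (1 / 2 / α i))
      ⟨by fun_prop, gammaMeasure_map_const_mul (by norm_num) (hα i)⟩ (hX i)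
    convert h using 2
    have h1 := (hα i).ne'
    have h2 := (hα (Fin.last n)).ne'
    rw [hr_def, uCoef]
    field_simp
    ring
  have hYi : iIndepFun (fun i ω => α i * X i ω) P :=
    hXi.comp (fun i x => α i * x) fun i => by fun_prop
  have hmix := fun k => gammaMeasure_eq_sum (half_pos (hm k)) hr (uCoef_nonneg hα hαa k)
    (uCoef_lt_one hα k)
  have hprob : ∀ k, IsProbabilityMeasure (gammaMeasure (m k / 2) (r * (1 - uCoef α k))) := fun k =>
    isProbabilityMeasure_gammaMeasure (half_pos (hm k))
      (mul_pos hr (sub_pos.2 (uCoef_lt_one hα k)))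
  have hprob' : ∀ k (j : ℕ), IsProbabilityMeasure (gammaMeasure (m k / 2 + j) r) := fun k j =>
    isProbabilityMeasure_gammaMeasure (add_pos_of_pos_of_nonneg (half_pos (hm k)) j.cast_nonneg) hr
  have hpi := hYi.hasLaw_pi hY
  refine HasLaw.fun_comp (Y := fun x : Fin (n + 1) → ℝ => ∑ k, x k) ⟨by fun_prop, ?_⟩ hpi
  -- Each mixture is σ-finite because it equals a gamma probability law; `pi_sum_smul` needs this.
  have hsf : ∀ k, SigmaFinite (Measure.sum fun j : ℕ =>
      ENNReal.ofReal (mixWeight α m k j) • gammaMeasure (m k / 2 + j) r) := fun k => by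
    have := hprob k
    rw [hmix k] at this
    unfold mixWeight
    infer_instance
  have hpeq : (Measure.pi fun k => gammaMeasure (m k / 2) (r * (1 - uCoef α k))) =
      Measure.pi fun k => Measure.sum fun j : ℕ =>
        ENNReal.ofReal (mixWeight α m k j) • gammaMeasure (m k / 2 + j) r := by
    congr 1
    ext1 k
    rw [hmix k]
    rfl
  rw [hpeq, pi_sum_smul, Measure.map_sum (by fun_prop), sumLaw]
  congr 1
  ext1 i
  rw [Measure.map_smul, pi_gammaMeasure_map_sum (fun k =>
    add_pos_of_pos_of_nonneg (half_pos (hm k)) (i k).cast_nonneg) hr, Finset.sum_add_distrib,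
    mTot, Finset.sum_div, Nat.cast_sum]

/-! ### Distribution function of the ratio. -/

/-- Each term of `gammaMeasure_Iic` times the density of `v` is again an unnormalised gamma density:
exponents and rates add. -/
lemma lintegral_gammaMeasure_Iic {s r q r' c : ℝ} (hs : 0 < s) (hr : 0 < r) (hq : 0 < q)
    (hr' : 0 < r') (hc : 0 < c) :
    ∫⁻ v, gammaMeasure s r (Iic (c * v)) ∂(gammaMeasure q r') = ∑' l : ℕ,
      ENNReal.ofReal ((r * c) ^ (s + l) * r' ^ q / (r * c + r') ^ (s + l + q) *
        (Gamma (s + l + q) / (Gamma (s + l + 1) * Gamma q))) := by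
  have hG := Gamma_pos_of_pos hq
  have h1 : ∫⁻ v, gammaMeasure s r (Iic (c * v)) ∂(gammaMeasure q r') =
      ∫⁻ v, ∑' l : ℕ, ENNReal.ofReal ((r * (c * v)) ^ (s + l) * exp (-(r * (c * v))) /
        Gamma (s + l + 1)) ∂(gammaMeasure q r') := by
    refine lintegral_congr_ae ?_
    filter_upwards [ae_pos_gammaMeasure q r'] with v hv
    exact gammaMeasure_Iic hs hr (mul_pos hc hv)
  rw [h1, lintegral_tsum fun l => by fun_prop]
  refine tsum_congr fun l => ?_
  have hGl : 0 < Gamma (s + l + 1) := Gamma_pos_of_pos (by positivity)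
  have hGl' : 0 < Gamma (s + l + q) := Gamma_pos_of_pos (by positivity)
  rw [lintegral_gammaMeasure _ _ (by fun_prop),
    setLIntegral_congr_fun (g := fun v => ENNReal.ofReal
      ((r * c) ^ (s + l) * r' ^ q / (Gamma (s + l + 1) * Gamma q)) *
        ENNReal.ofReal (v ^ (s + l + q - 1) * exp (-((r * c + r') * v)))) measurableSet_Ioi,
    lintegral_const_mul _ (by fun_prop), lintegral_rpow_mul_exp_neg (by positivity) (by positivity),
    ← ENNReal.ofReal_mul (by positivity)]
  · congr 1
    field_simp
  · intro v hv
    have hv : 0 < v := hv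
    simp only []
    rw [← ENNReal.ofReal_mul (by positivity), ← ENNReal.ofReal_mul (by positivity), ← mul_assoc r,
      mul_rpow (by positivity) hv.le, show s + l + q - 1 = (s + l) + (q - 1) by ring,
      rpow_add hv (s + l) (q - 1), show -((r * c + r') * v) = -(r * c * v) + -(r' * v) by ring, exp_add]
    congr 1
    field_simp

lemma cdf_genFStat {Ω : Type*} [MeasurableSpace Ω] {P : Measure Ω} [IsProbabilityMeasure P] {n : ℕ}
    {α m : Fin (n + 1) → ℝ} {ν : ℝ} (hα : ∀ i, 0 < α i) (hαa : Antitone α) (hm : ∀ i, 0 < m i)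
    (hν : 0 < ν) {X : Fin (n + 1) → Ω → ℝ} {V : Ω → ℝ}
    (hX : ∀ i, HasLaw (X i) (chiSquare (m i)) P) (hV : HasLaw V (chiSquare ν) P)
    (hXi : iIndepFun X P) (hXV : IndepFun (fun ω i => X i ω) V P) (y : ℝ) :
    ENNReal.ofReal (cdf (P.map (genFStat α m ν X V)) y) =
      ∑' i : Fin (n + 1) → ℕ, (∏ k, ENNReal.ofReal (mixWeight α m k (i k))) *
        ∫⁻ v, gammaMeasure (mTot m / 2 + (∑ k, i k : ℕ)) (1 / (2 * α (Fin.last n)))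
          (Iic (y * mTot m / ν * v)) ∂(chiSquare ν) := by
  have hM := mTot_pos hm
  have hT := hasLaw_sum hα hαa hm hX hXi
  have hTV : IndepFun (fun ω => ∑ i, α i * X i ω) V P :=
    hXV.comp (φ := fun x : Fin (n + 1) → ℝ => ∑ i, α i * x i) (ψ := id) (by fun_prop) measurable_id
  have hTm := hT.aemeasurable
  have hVm := hV.aemeasurable
  have hW : AEMeasurable (genFStat α m ν X V) P := (hTm.div_const _).div (hVm.div_const _)
  have := Measure.isProbabilityMeasure_map hW
  have : IsProbabilityMeasure (sumLaw α m) := hT.isProbabilityMeasure_iff.1 inferInstance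
  have : IsProbabilityMeasure (chiSquare ν) := hV.isProbabilityMeasure_iff.1 inferInstance
  have hprod : HasLaw (fun ω => (∑ i, α i * X i ω, V ω)) ((sumLaw α m).prod (chiSquare ν)) P :=
    (indepFun_iff_hasLaw_prodMk_prod hT hV).1 hTV
  have hVpos : ∀ᵐ ω ∂P, 0 < V ω :=
    (hV.ae_iff (p := fun v => 0 < v) measurableSet_Ioi.mem).2 (ae_pos_gammaMeasure _ _)
  have hset : MeasurableSet {p : ℝ × ℝ | p.1 ≤ y * mTot m / ν * p.2} :=
    measurableSet_le (by fun_prop) (by fun_prop)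
  rw [ofReal_cdf, Measure.map_apply_of_aemeasurable hW measurableSet_Iic]
  calc P (genFStat α m ν X V ⁻¹' Iic y)
      = P {ω | ∑ i, α i * X i ω ≤ y * mTot m / ν * V ω} := by
        refine measure_congr ?_
        filter_upwards [hVpos] with ω hω
        refine propext ?_
        change genFStat α m ν X V ω ≤ y ↔ ∑ i, α i * X i ω ≤ y * mTot m / ν * V ω
        rw [genFStat, div_le_iff₀ (by positivity), div_le_iff₀ hM]
        ring_nf
    _ = ((sumLaw α m).prod (chiSquare ν)) {p | p.1 ≤ y * mTot m / ν * p.2} :=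
        hprod.measure_eq (p := fun p => p.1 ≤ y * mTot m / ν * p.2) hset
    _ = ∫⁻ v, sumLaw α m (Iic (y * mTot m / ν * v)) ∂(chiSquare ν) := by
        rw [Measure.prod_apply_symm hset]
        rfl
    _ = _ := by
        simp_rw [sumLaw, Measure.sum_apply _ measurableSet_Iic, Measure.smul_apply, smul_eq_mul]
        -- Measurability in `v` comes from monotonicity of the distribution function.
        have hmeas : ∀ s r : ℝ, Measurable fun v => gammaMeasure s r (Iic (y * mTot m / ν * v)) := by
          intro s r
          have hmono : Monotone fun x => gammaMeasure s r (Iic x) :=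
            fun a b hab => measure_mono (Iic_subset_Iic.2 hab)
          exact hmono.measurable.comp (by fun_prop)
        rw [lintegral_tsum fun i => ((hmeas _ _).const_mul _).aemeasurable]
        refine tsum_congr fun i => ?_
        rw [lintegral_const_mul _ (hmeas _ _)]

/-! ### Degree weights and their generating function. -/

/-- The binomial series, obtained by comparing total masses in `gammaMeasure_eq_sum`. -/
lemma tsum_ofReal_poch {s x : ℝ} (hs : 0 < s) (hx0 : 0 ≤ x) (hx1 : x < 1) :
    ∑' j : ℕ, ENNReal.ofReal (poch s j / (Nat.factorial j : ℝ) * x ^ j) =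
      ENNReal.ofReal ((1 - x) ^ (-s)) := by
  have h1x := sub_pos.2 hx1
  have h0 := isProbabilityMeasure_gammaMeasure hs (mul_pos one_pos h1x)
  have hj : ∀ j : ℕ, IsProbabilityMeasure (gammaMeasure (s + j) 1) := fun j =>
    isProbabilityMeasure_gammaMeasure (add_pos_of_pos_of_nonneg hs j.cast_nonneg) one_pos
  have hc : 0 < (1 - x) ^ s := rpow_pos_of_pos h1x _
  have h := congrArg (fun μ => μ univ) (gammaMeasure_eq_sum hs one_pos hx0 hx1)
  simp only [measure_univ, Measure.sum_apply _ MeasurableSet.univ, Measure.smul_apply,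
    smul_eq_mul, mul_one, ENNReal.ofReal_mul hc.le, ENNReal.tsum_mul_left] at h
  rw [ENNReal.eq_inv_of_mul_eq_one_left ((mul_comm _ _).trans h.symm),
    ← ENNReal.ofReal_inv_of_pos hc, rpow_neg h1x.le]

/-- The total weight of the mixture components of degree `j`. -/
def degWeight {n : ℕ} (α m : Fin (n + 1) → ℝ) (j : ℕ) : ℝ≥0∞ :=
  ∑' i : Fin (n + 1) → ℕ,
    if ∑ k, i k = j then ∏ k, ENNReal.ofReal (mixWeight α m k (i k)) else 0

section

variable {n : ℕ} {α m : Fin (n + 1) → ℝ}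

lemma tsum_prod_mixWeight_mul (F : ℕ → ℝ≥0∞) :
    ∑' i : Fin (n + 1) → ℕ, (∏ k, ENNReal.ofReal (mixWeight α m k (i k))) * F (∑ k, i k) =
      ∑' j, degWeight α m j * F j := by
  simp_rw [degWeight, ← ENNReal.tsum_mul_right]
  rw [ENNReal.tsum_comm]
  refine tsum_congr fun i => ?_
  rw [tsum_eq_single (∑ k, i k) fun j hj => by rw [if_neg hj.symm, zero_mul], if_pos rfl]

lemma tsum_degWeight_mul_pow (hα : ∀ i, 0 < α i) (hαa : Antitone α) (hm : ∀ i, 0 < m i)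
    {z : ℝ} (hz0 : 0 ≤ z) (hz1 : z ≤ 1) :
    ∑' j, degWeight α m j * ENNReal.ofReal (z ^ j) = ENNReal.ofReal (genFun α m z) := by
  rw [← tsum_prod_mixWeight_mul fun j => ENNReal.ofReal (z ^ j)]
  have hu0 := uCoef_nonneg hα hαa
  have hu1 : ∀ k, 0 < 1 - uCoef α k := fun k => sub_pos.2 (uCoef_lt_one hα k)
  have huz : ∀ k, uCoef α k * z < 1 := fun k =>
    (mul_le_of_le_one_right (hu0 k) hz1).trans_lt (uCoef_lt_one hα k)
  have hterm : ∀ i : Fin (n + 1) → ℕ, (∏ k, ENNReal.ofReal (mixWeight α m k (i k))) *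
      ENNReal.ofReal (z ^ ∑ k, i k) = ∏ k, (ENNReal.ofReal ((1 - uCoef α k) ^ (m k / 2)) *
        ENNReal.ofReal (poch (m k / 2) (i k) / (Nat.factorial (i k) : ℝ) *
          (uCoef α k * z) ^ i k)) := by
    intro i
    rw [← Finset.prod_pow_eq_pow_sum, ENNReal.ofReal_prod_of_nonneg fun k _ => by positivity,
      ← Finset.prod_mul_distrib]
    refine Finset.prod_congr rfl fun k _ => ?_
    rw [← ENNReal.ofReal_mul (mixWeight_nonneg hα hαa hm _ _),
      ← ENNReal.ofReal_mul (rpow_pos_of_pos (hu1 k) _).le, mixWeight, mul_pow]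
    congr 1
    ring
  simp_rw [hterm]
  rw [← prod_tsum_eq_tsum_pi (fun k j => ENNReal.ofReal ((1 - uCoef α k) ^ (m k / 2)) *
    ENNReal.ofReal (poch (m k / 2) j / (Nat.factorial j : ℝ) * (uCoef α k * z) ^ j))]
  simp_rw [ENNReal.tsum_mul_left]
  rw [Finset.prod_mul_distrib,
    ← ENNReal.ofReal_prod_of_nonneg fun k _ => (rpow_pos_of_pos (hu1 k) _).le, ← constA_eq hα,
    Finset.prod_congr rfl fun k _ => tsum_ofReal_poch (half_pos (hm k))
      (mul_nonneg (hu0 k) hz0) (huz k),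
    ← ENNReal.ofReal_prod_of_nonneg fun k _ => (rpow_pos_of_pos (sub_pos.2 (huz k)) _).le,
    ← ENNReal.ofReal_mul (constA_pos hα).le, genFun]

lemma tsum_degWeight_ne_top (hα : ∀ i, 0 < α i) (hαa : Antitone α) (hm : ∀ i, 0 < m i) :
    ∑' j, degWeight α m j ≠ ∞ := by
  have h := tsum_degWeight_mul_pow hα hαa hm zero_le_one le_rfl
  simp only [one_pow, ENNReal.ofReal_one, mul_one] at h
  exact h ▸ ENNReal.ofReal_ne_top

lemma analyticAt_genFun : AnalyticAt ℝ (genFun α m) 0 := by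
  unfold genFun
  refine analyticAt_const.mul (Finset.analyticAt_fun_prod _ fun k _ => ?_)
  have h : AnalyticAt ℝ (fun x : ℝ => (1 + x) ^ (-(m k / 2))) 0 :=
    one_add_rpow_hasFPowerSeriesAt_zero.analyticAt
  have h' : AnalyticAt ℝ (fun z : ℝ => -(uCoef α k * z)) 0 := by fun_prop
  simpa [Function.comp_def, sub_eq_add_neg] using h.comp_of_eq h' (by simp)

/-- The weights are summable, so their power series has radius at least `1`. It agrees with `genFun`
on `[0, 1]`; the identity principle and uniqueness of power series then match the coefficients. -/
lemma cCoef_eq_toReal_degWeight (hα : ∀ i, 0 < α i) (hαa : Antitone α) (hm : ∀ i, 0 < m i)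
    (j : ℕ) : cCoef α m j = (degWeight α m j).toReal := by
  have hd := tsum_degWeight_ne_top hα hαa hm
  have hdj := ENNReal.ne_top_of_tsum_ne_top hd
  have hsum : Summable fun j => (degWeight α m j).toReal := ENNReal.summable_toReal hd
  set p := FormalMultilinearSeries.ofScalars ℝ fun j => (degWeight α m j).toReal with hp
  have hrad : 1 ≤ p.radius := by
    refine p.le_radius_of_summable (r := 1) ?_
    simpa [hp, FormalMultilinearSeries.ofScalars_norm] using hsum
  have hps := p.hasFPowerSeriesOnBall (one_pos.trans_le hrad)
  have hsumeq : ∀ z : ℝ, 0 ≤ z → z ≤ 1 → genFun α m z = p.sum z := by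
    intro z hz0 hz1
    have hg : 0 ≤ genFun α m z := mul_nonneg (constA_pos hα).le <| Finset.prod_nonneg fun k _ => by
      have := mul_le_of_le_one_right (uCoef_nonneg hα hαa k) hz1
      have := uCoef_lt_one hα k
      exact rpow_nonneg (by linarith) _
    have h := tsum_degWeight_mul_pow hα hαa hm hz0 hz1
    rw [← ENNReal.toReal_ofReal hg, ← h,
      ENNReal.tsum_toReal_eq fun j => ENNReal.mul_ne_top (hdj j) ENNReal.ofReal_ne_top]
    simp only [FormalMultilinearSeries.sum, hp, FormalMultilinearSeries.ofScalars_apply_eq,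
      ENNReal.toReal_mul, smul_eq_mul, ENNReal.toReal_ofReal (pow_nonneg hz0 _)]
  have hev : genFun α m =ᶠ[nhds 0] p.sum := by
    refine (analyticAt_genFun.frequently_eq_iff_eventually_eq hps.analyticAt).1 ?_
    -- Agreement is known only for `z ≥ 0`, but these points accumulate at `0`, which suffices.
    have hfr : ∃ᶠ z in nhdsWithin (0 : ℝ) (Ioi 0), genFun α m z = p.sum z := by
      refine Filter.Eventually.frequently ?_
      filter_upwards [Ioo_mem_nhdsGT (zero_lt_one (α := ℝ))] with z hz
      exact hsumeq z hz.1.le hz.2.le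
    exact hfr.filter_mono (nhdsWithin_mono _ fun z hz => ne_of_gt hz)
  have hpg : HasFPowerSeriesAt (genFun α m) p 0 := hps.hasFPowerSeriesAt.congr hev.symm
  have heq := hpg.eq_formalMultilinearSeries analyticAt_genFun.hasFPowerSeriesAt
  have hinj := FormalMultilinearSeries.ofScalars_series_injective ℝ ℝ (hp.symm.trans heq)
  exact (congrFun hinj j).symm

lemma ofReal_cCoef (hα : ∀ i, 0 < α i) (hαa : Antitone α) (hm : ∀ i, 0 < m i)
    (j : ℕ) : ENNReal.ofReal (cCoef α m j) = degWeight α m j := by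
  rw [cCoef_eq_toReal_degWeight hα hαa hm, ENNReal.ofReal_toReal
    (ENNReal.ne_top_of_tsum_ne_top (tsum_degWeight_ne_top hα hαa hm) j)]

lemma cCoef_nonneg (hα : ∀ i, 0 < α i) (hαa : Antitone α) (hm : ∀ i, 0 < m i)
    (j : ℕ) : 0 ≤ cCoef α m j := by
  rw [cCoef_eq_toReal_degWeight hα hαa hm]
  exact ENNReal.toReal_nonneg

end

/-- The contribution to the distribution function of `genFStat` at `y` of a mixture component of
unit weight at total degree `N`. -/
def cdfKernel {n : ℕ} (α m : Fin (n + 1) → ℝ) (ν y : ℝ) (N : ℕ) : ℝ :=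
  constB0 α m ν * y ^ (mTot m / 2) * (aParam α m ν + y) ^ (-((ν + mTot m) / 2)) *
    (poch ((ν + mTot m) / 2) N / poch (mTot m / 2) (N + 1) * tFun α m ν y ^ N)

/-! ### The kernel depending on total degree. -/

section

variable {n : ℕ} {α m : Fin (n + 1) → ℝ} {ν y : ℝ}

lemma aParam_pos (hα : ∀ i, 0 < α i) (hm : ∀ i, 0 < m i) (hν : 0 < ν) : 0 < aParam α m ν :=
  div_pos (mul_pos hν (hα _)) (mTot_pos hm)

lemma constB0_pos (hα : ∀ i, 0 < α i) (hm : ∀ i, 0 < m i) (hν : 0 < ν) : 0 < constB0 α m ν := by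
  have hM := mTot_pos hm
  have ha := aParam_pos hα hm hν
  have h1 := Gamma_pos_of_pos (half_pos hM)
  have h2 := Gamma_pos_of_pos (half_pos hν)
  have h3 := Gamma_pos_of_pos (half_pos (add_pos hν hM))
  unfold constB0
  positivity

lemma lintegral_gammaMeasure_eq_cdfKernel (hα : ∀ i, 0 < α i) (hm : ∀ i, 0 < m i) (hν : 0 < ν)
    (hy : 0 < y) (N : ℕ) :
    ∫⁻ v, gammaMeasure (mTot m / 2 + N) (1 / (2 * α (Fin.last n)))
      (Iic (y * mTot m / ν * v)) ∂(chiSquare ν) =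
      ∑' l : ℕ, ENNReal.ofReal (cdfKernel α m ν y (N + l)) := by
  have hM := mTot_pos hm
  have ha := aParam_pos hα hm hν
  have hαl := hα (Fin.last n)
  have hpq : 0 < (ν + mTot m) / 2 := half_pos (add_pos hν hM)
  have hG1 := Gamma_pos_of_pos (half_pos hM)
  have hG2 := Gamma_pos_of_pos (half_pos hν)
  rw [chiSquare, lintegral_gammaMeasure_Iic (by positivity) (by positivity) (by positivity)
    (by positivity) (by positivity)]
  refine tsum_congr fun l => ?_
  congr 1
  have hrc : 1 / (2 * α (Fin.last n)) * (y * mTot m / ν) = y / (2 * aParam α m ν) := by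
    rw [aParam]
    field_simp
  have e1 : y / (2 * aParam α m ν) + 1 / 2 = (aParam α m ν + y) / (2 * aParam α m ν) := by
    field_simp
    ring
  have e2 : (1 / 2 : ℝ) = aParam α m ν / (2 * aParam α m ν) := by field_simp
  -- The two rates are `y / (2a)` and `a / (2a)`; the powers of `2a` cancel.
  have hpow : ∀ S q : ℝ, (y / (2 * aParam α m ν)) ^ S * (1 / 2) ^ q /
      (y / (2 * aParam α m ν) + 1 / 2) ^ (S + q) =
      aParam α m ν ^ q * y ^ S * (aParam α m ν + y) ^ (-(S + q)) := by
    intro S q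
    have h2a : 0 < 2 * aParam α m ν := by positivity
    rw [e1, e2, div_rpow hy.le h2a.le, div_rpow ha.le h2a.le, div_rpow (by positivity) h2a.le,
      rpow_neg (by positivity), rpow_add h2a]
    have h3 := rpow_pos_of_pos h2a S
    have h4 := rpow_pos_of_pos h2a q
    field_simp
  have hS : mTot m / 2 + (N : ℝ) + l = mTot m / 2 + (N + l : ℕ) := by push_cast; ring
  have hSq : mTot m / 2 + ((N + l : ℕ) : ℝ) + ν / 2 = (ν + mTot m) / 2 + (N + l : ℕ) := by ring
  have hS1 : mTot m / 2 + ((N + l : ℕ) : ℝ) + 1 = mTot m / 2 + (N + l + 1 : ℕ) := by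
    push_cast; ring
  rw [hrc, hpow, hS, hS1, hSq, Gamma_add_natCast hpq, Gamma_add_natCast (half_pos hM), neg_add,
    rpow_add hy, rpow_natCast, rpow_add (by positivity), rpow_neg_natCast, zpow_neg, zpow_natCast,
    cdfKernel, constB0, tFun, div_pow]
  have := poch_pos (half_pos hM) (N + l + 1)
  field_simp

end

section Statistic

variable {Ω : Type*} [MeasurableSpace Ω] {P : Measure Ω} [IsProbabilityMeasure P] {n : ℕ}
  {α m : Fin (n + 1) → ℝ} {ν y : ℝ} {X : Fin (n + 1) → Ω → ℝ} {V : Ω → ℝ}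

lemma ofReal_cdf_eq_tsum (hα : ∀ i, 0 < α i) (hαa : Antitone α) (hm : ∀ i, 0 < m i)
    (hν : 0 < ν) (hX : ∀ i, HasLaw (X i) (chiSquare (m i)) P) (hV : HasLaw V (chiSquare ν) P)
    (hXi : iIndepFun X P) (hXV : IndepFun (fun ω i => X i ω) V P) (hy : 0 < y) :
    ENNReal.ofReal (cdf (P.map (genFStat α m ν X V)) y) =
      ∑' i : Fin (n + 1) → ℕ, (∏ k, ENNReal.ofReal (mixWeight α m k (i k))) *
        ∑' l : ℕ, ENNReal.ofReal (cdfKernel α m ν y (∑ k, i k + l)) := by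
  rw [cdf_genFStat hα hαa hm hν hX hV hXi hXV]
  simp_rw [lintegral_gammaMeasure_eq_cdfKernel hα hm hν hy]

lemma cdf_zero (hα : ∀ i, 0 < α i) (hαa : Antitone α) (hm : ∀ i, 0 < m i)
    (hν : 0 < ν) (hX : ∀ i, HasLaw (X i) (chiSquare (m i)) P) (hV : HasLaw V (chiSquare ν) P)
    (hXi : iIndepFun X P) (hXV : IndepFun (fun ω i => X i ω) V P) :
    cdf (P.map (genFStat α m ν X V)) 0 = 0 := by
  have h := cdf_genFStat hα hαa hm hν hX hV hXi hXV 0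
  have h0 : ∀ s r : ℝ, gammaMeasure s r (Iic 0) = 0 := fun s r => by
    have := ae_pos_gammaMeasure s r
    rw [ae_iff] at this
    simpa [Iic] using this
  simp only [zero_mul, zero_div, h0, lintegral_zero, mul_zero, tsum_zero] at h
  exact le_antisymm (ENNReal.ofReal_eq_zero.1 h) (cdf_nonneg _ _)

end Statistic

/-- Summability and the value of a series of nonnegative terms, from its finite `ℝ≥0∞`-valued sum. -/
lemma summable_and_eq_mul_tsum {ι : Type*} {f : ι → ℝ} {c H : ℝ} (hc : 0 < c) (hH : 0 ≤ H)
    (hf : ∀ i, 0 ≤ f i) (h : ENNReal.ofReal H = ∑' i, ENNReal.ofReal (c * f i)) :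
    Summable f ∧ H = c * ∑' i, f i := by
  have hs : Summable fun i => c * f i := by
    have := ENNReal.summable_toReal (h ▸ ENNReal.ofReal_ne_top)
    simpa only [ENNReal.toReal_ofReal (mul_nonneg hc.le (hf _))] using this
  refine ⟨(summable_mul_left_iff hc.ne').1 hs, ?_⟩
  rw [← ENNReal.ofReal_tsum_of_nonneg (fun i => mul_nonneg hc.le (hf i)) hs, tsum_mul_left] at h
  exact (ENNReal.ofReal_eq_ofReal_iff hH (mul_nonneg hc.le (tsum_nonneg hf))).1 h

lemma tsum_pi_snoc {n : ℕ} (F : (Fin (n + 1) → ℕ) → ℝ≥0∞) :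
    ∑' i, F i = ∑' (i : Fin n → ℕ) (l : ℕ), F (Fin.snoc (α := fun _ => ℕ) i l) := by
  rw [← (Fin.snocEquiv fun _ : Fin (n + 1) => ℕ).tsum_eq, ENNReal.tsum_prod', ENNReal.tsum_comm]
  rfl

/-! ### The Lauricella series and the single series. -/

section

variable {n : ℕ} {α m : Fin (n + 1) → ℝ} {ν y : ℝ}

lemma mixWeight_last (hα : ∀ i, 0 < α i) (j : ℕ) :
    mixWeight α m (Fin.last n) j = if j = 0 then 1 else 0 := by
  rw [mixWeight, uCoef_last hα]
  split_ifs with h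
  · simp [h, poch]
  · simp [h]

/-- As `u_r = 0`, the last component is not mixed. Dropping its index frees a slot for `l`. -/
lemma tsum_mixWeight_last (hα : ∀ i, 0 < α i) (F : ℕ → ℝ≥0∞) :
    ∑' i : Fin (n + 1) → ℕ, (∏ k, ENNReal.ofReal (mixWeight α m k (i k))) * F (∑ k, i k) =
      ∑' i : Fin n → ℕ, (∏ k : Fin n, ENNReal.ofReal (mixWeight α m k.castSucc (i k))) *
        F (∑ k, i k) := by
  rw [tsum_pi_snoc]
  refine tsum_congr fun i => ?_
  rw [tsum_eq_single 0 fun l hl => by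
    rw [Fin.prod_univ_castSucc, Fin.snoc_last, mixWeight_last hα, if_neg hl]; simp]
  simp [Fin.prod_univ_castSucc, Fin.sum_univ_castSucc, mixWeight_last hα]

lemma tFun_nonneg (hα : ∀ i, 0 < α i) (hm : ∀ i, 0 < m i) (hν : 0 < ν) (hy : 0 ≤ y) :
    0 ≤ tFun α m ν y :=
  div_nonneg hy (add_pos_of_pos_of_nonneg (aParam_pos hα hm hν) hy).le

/-- The last parameter `1` gives `(1)_l / l! = 1`, so `l` enters only through the total degree. -/
lemma lauricellaFDTerm_snoc (i : Fin n → ℕ) (l : ℕ) :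
    lauricellaFDTerm ((ν + mTot m) / 2) (bVec m) (mTot m / 2 + 1) (xVec α m ν y)
      (Fin.snoc (α := fun _ => ℕ) i l) =
    poch ((ν + mTot m) / 2) (∑ k, i k + l) / poch (mTot m / 2 + 1) (∑ k, i k + l) *
      ((∏ k : Fin n, poch (m k.castSucc / 2) (i k) / (Nat.factorial (i k) : ℝ) *
        uCoef α k.castSucc ^ i k) * tFun α m ν y ^ (∑ k, i k + l)) := by
  have hl : (Nat.factorial l : ℝ) ≠ 0 := by positivity
  simp only [lauricellaFDTerm, bVec, xVec, Fin.prod_univ_castSucc, Fin.sum_univ_castSucc,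
    Fin.snoc_last, Fin.snoc_castSucc, poch_one, div_self hl, one_mul]
  simp only [mul_pow, pow_add, Finset.prod_mul_distrib, Finset.prod_pow_eq_pow_sum]
  ring

lemma lauricellaFDTerm_snoc_nonneg (hα : ∀ i, 0 < α i) (hαa : Antitone α) (hm : ∀ i, 0 < m i)
    (hν : 0 < ν) (hy : 0 ≤ y) (i : Fin n → ℕ) (l : ℕ) :
    0 ≤ lauricellaFDTerm ((ν + mTot m) / 2) (bVec m) (mTot m / 2 + 1) (xVec α m ν y)
      (Fin.snoc (α := fun _ => ℕ) i l) := by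
  have hM := mTot_pos hm
  rw [lauricellaFDTerm_snoc]
  refine mul_nonneg (div_nonneg (poch_pos (half_pos (add_pos hν hM)) _).le
    (poch_pos (by positivity) _).le) (mul_nonneg (Finset.prod_nonneg fun k _ => ?_)
      (pow_nonneg (tFun_nonneg hα hm hν hy) _))
  have := poch_pos (half_pos (hm k.castSucc)) (i k)
  have := uCoef_nonneg hα hαa k.castSucc
  positivity

lemma prod_mixWeight_mul_cdfKernel (hα : ∀ i, 0 < α i) (hm : ∀ i, 0 < m i) (hν : 0 < ν)
    (hy : 0 < y) (i : Fin n → ℕ) (l : ℕ) :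
    (∏ k : Fin n, mixWeight α m k.castSucc (i k)) * cdfKernel α m ν y (∑ k, i k + l) =
      constA α m * constB0 α m ν * (y ^ (mTot m / 2) /
        (mTot m / 2 * (aParam α m ν + y) ^ ((ν + mTot m) / 2))) *
      lauricellaFDTerm ((ν + mTot m) / 2) (bVec m) (mTot m / 2 + 1) (xVec α m ν y)
        (Fin.snoc (α := fun _ => ℕ) i l) := by
  have hM := mTot_pos hm
  have ha := aParam_pos hα hm hν
  rw [lauricellaFDTerm_snoc, cdfKernel, poch_succ_left, rpow_neg (by positivity), constA_eq hα,
    Fin.prod_univ_castSucc, uCoef_last hα, sub_zero, one_rpow, mul_one]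
  simp only [mixWeight]
  rw [Finset.prod_mul_distrib]
  have h1 := poch_pos (a := mTot m / 2 + 1) (by positivity) (∑ k, i k + l)
  field_simp

lemma cdfSeriesTerm_nonneg (hα : ∀ i, 0 < α i) (hαa : Antitone α) (hm : ∀ i, 0 < m i)
    (hν : 0 < ν) (hy : 0 ≤ y) (j : ℕ) : 0 ≤ cdfSeriesTerm α m ν y j := by
  have hM := mTot_pos hm
  have := poch_pos (half_pos (add_pos hν hM)) j
  have := poch_pos (half_pos hM) (j + 1)
  have := tFun_nonneg hα hm hν hy
  have := Finset.sum_nonneg fun i (_ : i ∈ Finset.range (j + 1)) => cCoef_nonneg hα hαa hm i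
  unfold cdfSeriesTerm
  positivity

/-- Sum over `j + l = N`: the kernel is constant there, and the weights of degree `j ≤ N` add up to
the partial sum of the `c_j`. -/
lemma tsum_degWeight_mul_tsum_cdfKernel (hα : ∀ i, 0 < α i) (hαa : Antitone α)
    (hm : ∀ i, 0 < m i) :
    ∑' j, degWeight α m j * ∑' l : ℕ, ENNReal.ofReal (cdfKernel α m ν y (j + l)) =
      ∑' N, ENNReal.ofReal (constB0 α m ν * y ^ (mTot m / 2) *
        (aParam α m ν + y) ^ (-((ν + mTot m) / 2)) * cdfSeriesTerm α m ν y N) := by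
  simp_rw [← ENNReal.tsum_mul_left]
  rw [← ENNReal.tsum_prod' (f := fun p : ℕ × ℕ => degWeight α m p.1 *
      ENNReal.ofReal (cdfKernel α m ν y (p.1 + p.2))),
    ← Finset.HasAntidiagonal.sigmaAntidiagonalEquivProd.tsum_eq, ENNReal.tsum_sigma']
  refine tsum_congr fun N => ?_
  have hN : ∑ p ∈ Finset.HasAntidiagonal.antidiagonal N,
      degWeight α m p.1 * ENNReal.ofReal (cdfKernel α m ν y (p.1 + p.2)) =
      ∑ p ∈ Finset.HasAntidiagonal.antidiagonal N, degWeight α m p.1 * ENNReal.ofReal (cdfKernel α m ν y N) :=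
    Finset.sum_congr rfl fun p hp => by rw [Finset.HasAntidiagonal.mem_antidiagonal.1 hp]
  rw [tsum_fintype]
  simp only [Finset.HasAntidiagonal.sigmaAntidiagonalEquivProd_apply]
  rw [Finset.univ_eq_attach, Finset.sum_attach (Finset.HasAntidiagonal.antidiagonal N) fun p =>
      degWeight α m p.1 * ENNReal.ofReal (cdfKernel α m ν y (p.1 + p.2)),
    hN,
    Finset.Nat.sum_antidiagonal_eq_sum_range_succ_mk]
  simp only []
  rw [← Finset.sum_mul,
    Finset.sum_congr rfl fun i _ => (ofReal_cCoef hα hαa hm i).symm,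
    ← ENNReal.ofReal_sum_of_nonneg fun i _ => cCoef_nonneg hα hαa hm i,
    ← ENNReal.ofReal_mul (Finset.sum_nonneg fun i _ => cCoef_nonneg hα hαa hm i)]
  congr 1
  rw [cdfKernel, cdfSeriesTerm]
  ring

lemma tFun_zero : tFun α m ν 0 = 0 := zero_div _

lemma summable_lauricellaFDTerm_zero (a c : ℝ) (b : Fin (n + 1) → ℝ) :
    Summable (lauricellaFDTerm a b c (xVec α m ν 0)) := by
  refine summable_of_ne_finset_zero (s := {0}) fun i hi => ?_
  obtain ⟨k, hk⟩ : ∃ k, i k ≠ 0 := Function.ne_iff.1 (Finset.notMem_singleton.1 hi)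
  have hx : xVec α m ν 0 k = 0 := by
    refine Fin.lastCases ?_ (fun k => ?_) k <;> simp [xVec, tFun_zero]
  rw [lauricellaFDTerm, Finset.prod_eq_zero (Finset.mem_univ k) (by simp [hx, show i k ≠ 0 from hk]), mul_zero]

lemma summable_cdfSeriesTerm_zero : Summable (cdfSeriesTerm α m ν 0) := by
  refine summable_of_ne_finset_zero (s := {0}) fun j hj => ?_
  have hj : j ≠ 0 := by simpa using hj
  simp [cdfSeriesTerm, tFun_zero, hj]

end

end GenF

end

theorem theorem3 {Ω : Type*} [MeasurableSpace Ω] (P : Measure Ω) [IsProbabilityMeasure P]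
    (n : ℕ) (hr : 2 ≤ n + 1)
    (α m : Fin (n + 1) → ℝ) (ν : ℝ)
    (hα : ∀ i, 0 < α i) (hαa : Antitone α) (hm : ∀ i, 0 < m i) (hν : 0 < ν)
    (X : Fin (n + 1) → Ω → ℝ) (V : Ω → ℝ)
    (hX : ∀ i, HasLaw (X i) (GenF.chiSquare (m i)) P)
    (hV : HasLaw V (GenF.chiSquare ν) P)
    (hXi : iIndepFun X P)
    (hXV : IndepFun (fun ω i => X i ω) V P)
    (y : ℝ) (hy : 0 ≤ y) :
    (Summable (GenF.lauricellaFDTerm ((ν + GenF.mTot m) / 2) (GenF.bVec m)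
        (GenF.mTot m / 2 + 1) (GenF.xVec α m ν y)) ∧
      cdf (P.map (GenF.genFStat α m ν X V)) y =
        GenF.constA α m * GenF.constB0 α m ν *
          (y ^ (GenF.mTot m / 2) /
            (GenF.mTot m / 2 * (GenF.aParam α m ν + y) ^ ((ν + GenF.mTot m) / 2))) *
          GenF.lauricellaFD ((ν + GenF.mTot m) / 2) (GenF.bVec m)
            (GenF.mTot m / 2 + 1) (GenF.xVec α m ν y)) ∧
    (Summable (GenF.cdfSeriesTerm α m ν y) ∧
      cdf (P.map (GenF.genFStat α m ν X V)) y =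
        GenF.constB0 α m ν * y ^ (GenF.mTot m / 2) *
          (GenF.aParam α m ν + y) ^ (-((ν + GenF.mTot m) / 2)) *
          ∑' j, GenF.cdfSeriesTerm α m ν y j) := by
  have hM := GenF.mTot_pos hm
  -- The kernel computation needs `y > 0`. At `y = 0` both sides vanish since `0 ^ (|m| / 2) = 0`,
  -- and only the zero index can contribute to either series.
  rcases hy.eq_or_lt with rfl | hy0
  · have h0 := GenF.cdf_zero hα hαa hm hν hX hV hXi hXV
    have hp : (0 : ℝ) ^ (GenF.mTot m / 2) = 0 := Real.zero_rpow (half_pos hM).ne'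
    refine ⟨⟨GenF.summable_lauricellaFDTerm_zero _ _ _, ?_⟩,
      GenF.summable_cdfSeriesTerm_zero, ?_⟩ <;> simp [h0, hp]
  have ha := GenF.aParam_pos hα hm hν
  have hA := GenF.constA_pos (m := m) hα
  have hB := GenF.constB0_pos hα hm hν
  have hH := GenF.ofReal_cdf_eq_tsum hα hαa hm hν hX hV hXi hXV hy0
  refine ⟨GenF.summable_and_eq_mul_tsum (by positivity) (cdf_nonneg _ _) (fun i => ?_) ?_,
    GenF.summable_and_eq_mul_tsum (by positivity) (cdf_nonneg _ _)
      (GenF.cdfSeriesTerm_nonneg hα hαa hm hν hy) ?_⟩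
  · rw [← Fin.snoc_init_self (α := fun _ => ℕ) i]
    exact GenF.lauricellaFDTerm_snoc_nonneg hα hαa hm hν hy _ _
  · rw [hH, GenF.tsum_mixWeight_last hα fun N =>
      ∑' l : ℕ, ENNReal.ofReal (GenF.cdfKernel α m ν y (N + l)), GenF.tsum_pi_snoc]
    refine tsum_congr fun i => ?_
    rw [← ENNReal.tsum_mul_left]
    refine tsum_congr fun l => ?_
    rw [← ENNReal.ofReal_prod_of_nonneg fun k _ => GenF.mixWeight_nonneg hα hαa hm _ _,
      ← ENNReal.ofReal_mul (Finset.prod_nonneg fun k _ => GenF.mixWeight_nonneg hα hαa hm _ _),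
      GenF.prod_mixWeight_mul_cdfKernel hα hm hν hy0]
  · rw [hH, GenF.tsum_prod_mixWeight_mul fun N =>
      ∑' l : ℕ, ENNReal.ofReal (GenF.cdfKernel α m ν y (N + l)),
      GenF.tsum_degWeight_mul_tsum_cdfKernel hα hαa hm]
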